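/- Let $\mathcal{A}$ be a finitely cocomplete homological category, that is, a finitely cocomplete category which is pointed, regular and protomodular (the Split Short Five Lemma holds). Write $X\otimes Y$ for the kernel $\iota_{X,Y}\colon X\otimes Y\to X+Y$ of the comparison morphism $X+Y\to X\times Y$, and $X\otimes Y\otimes Z$ for the kernel $\iota_{X,Y,Z}\colon X\otimes Y\otimes Z\to X+Y+Z$ of the morphism $X+Y+Z\to (X+Y)\times(X+Z)\times(Y+Z)$ whose three components send $Z$, respectively $Y$, respectively $X$, to zero and are the coproduct inclusions on the other summands. Morphisms $f\otimes g$ and $f\otimes g\otimes h$ are induced by $f+g$ and $f+g+h$. For an object $X$ let $c^{X,X}=\nabla_X\circ\iota_{X,X}\colon X\otimes X\to X$, where $\nabla_X$ is the codiagonal. Let $S^{X,Y}_{2,1}\colon X\otimes X\otimes Y\to X\otimes Y$ and $S^{X,Y}_{1,2}\colon X\otimes Y\otimes Y\to X\otimes Y$ be the morphisms induced by $\nabla_X+1_Y$ and $1_X+\nabla_Y$; for $\psi\colon A\otimes G\to A$ put $\psi_{2,1}=\psi\circ S^{A,G}_{2,1}$ and $\psi_{1,2}=\psi\circ S^{A,G}_{1,2}$.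 Given $\psi\colon A\otimes G\to A$, let $q\colon A+G\to A\rtimes_\psi G$ be the coequaliser of $\iota_{A,G}$ and $\iota_A\circ\psi$, let $k_\psi=q\circ\iota_A$ and $s_\psi=q\circ\iota_G$, and let $p_\psi\colon A\rtimes_\psi G\to G$ be the morphism induced by the retraction $A+G\to G$. One says that $\psi$ determines an action of $G$ on $A$ when $k_\psi$ is a monomorphism. A precrossed module is a quadruple $(G,A,\mu,\partial)$ of objects $G$, $A$, a morphism $\mu\colon A\otimes G\to A$ which determines an action, and a morphism $\partial\colon A\to G$ with $\partial\circ\mu=c^{G,G}\circ(\partial\otimes 1_G)$. Its associated reflexive graph has object of arrows $A\rtimes_\mu G$, object of objects $G$, domain $d=p_\mu$, identities $e=s_\mu$, and codomain the unique morphism $c\colon A\rtimes_\mu G\to G$ with $c\circ k_\mu=\partial$ and $c\circ e=1_G$. The precrossed module is a crossed module when this reflexive graph is an internal category, that is, when it admits an associative and unital composition, compatible with $d$ and $c$, on the pullback of composable pairs. **Theorem.** A precrossed module $(G,A,\mu,\partial)$ in a finitely cocomplete homological category is a crossed module if and only if both of the following conditions hold: 1. $c^{A,A}=\partial^*(\mu)$,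 where $\partial^*(\mu)=\mu\circ(1_A\otimes\partial)\colon A\otimes A\to A$; 2. $\mu_{2,1}=\mu_{1,2}\circ(1_A\otimes\partial\otimes 1_G)\colon A\otimes A\otimes G\to A$. -/

import Mathlib

open CategoryTheory CategoryTheory.Limits

universe v u

noncomputable section

namespace CoSmash

attribute [local simp] prod.lift_fst prod.lift_snd prod.lift_fst_assoc prod.lift_snd_assoc
  coprod.inl_desc coprod.inr_desc coprod.inl_desc_assoc coprod.inr_desc_assoc
  pullback.lift_fst pullback.lift_snd pullback.lift_fst_assoc pullback.lift_snd_assoc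

/-! ### Homological categories -/

/-- A pointed category with kernels satisfies the Split Short Five Lemma: for every morphism
`(x, g)` from a point `(p', s')` to a point `(p, s)`, if `g` and the induced morphism between the
kernels of `p'` and `p` are isomorphisms, then so is `x`. A pointed category with pullbacks having
this property is called protomodular. -/
class Protomodular (C : Type u) [Category.{v} C] [HasZeroMorphisms C] [HasKernels C] : Prop where
  splitShortFive : ∀ {X' G' X G : C} (p' : X' ⟶ G') (s' : G' ⟶ X') (p : X ⟶ G) (s : G ⟶ X)
    (x : X' ⟶ X) (g : G' ⟶ G), s' ≫ p' = 𝟙 G' → s ≫ p = 𝟙 G →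
    ∀ (hp : p' ≫ g = x ≫ p), s' ≫ x = g ≫ s →
      IsIso (kernel.map p' p x g hp) → IsIso g → IsIso x

/-- A homological category: pointed, regular and protomodular. -/
class Homological (C : Type u) [Category.{v} C] [HasZeroObject C] [HasZeroMorphisms C] : Prop
    extends Regular C, Protomodular C

section Reflexive

variable {C : Type u} [Category.{v} C] [HasPullbacks C]

/-- A reflexive graph `(R, G, d, c, e)` in a category. -/
structure ReflexiveGraph (C : Type u) [Category.{v} C] where
  R : C
  G : C
  d : R ⟶ G
  c : R ⟶ G
  e : G ⟶ R
  e_d : e ≫ d = 𝟙 G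
  e_c : e ≫ c = 𝟙 G

/-- An internal category structure on a reflexive graph `(R, G, d, c, e)`, where `d` is the domain,
`c` the codomain and `e` the identities. The object of composable pairs is the pullback of `d`
and `c`; a generalized element `(β, α)` of it satisfies `d β = c α`, and `comp (β, α)` is the
composite "`β` after `α`". -/
structure InternalCategoryStructure (Γ : ReflexiveGraph C) where
  comp : pullback Γ.d Γ.c ⟶ Γ.R
  comp_d : comp ≫ Γ.d = pullback.snd Γ.d Γ.c ≫ Γ.d
  comp_c : comp ≫ Γ.c = pullback.fst Γ.d Γ.c ≫ Γ.c
  /-- `β ∘ id = β` -/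
  comp_id : pullback.lift (𝟙 Γ.R) (Γ.d ≫ Γ.e) (by simp [Γ.e_c]) ≫ comp = 𝟙 Γ.R
  /-- `id ∘ α = α` -/
  id_comp : pullback.lift (Γ.c ≫ Γ.e) (𝟙 Γ.R) (by simp [Γ.e_d]) ≫ comp = 𝟙 Γ.R
  /-- `(γ ∘ β) ∘ α = γ ∘ (β ∘ α)` for all generalized elements with `d γ = c β`, `d β = c α` -/
  assoc : ∀ {T : C} (γ β α : T ⟶ Γ.R) (h₁ : γ ≫ Γ.d = β ≫ Γ.c) (h₂ : β ≫ Γ.d = α ≫ Γ.c),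
    pullback.lift (pullback.lift γ β h₁ ≫ comp) α (by simp [comp_d, h₂]) ≫ comp =
      pullback.lift γ (pullback.lift β α h₂ ≫ comp) (by simp [comp_c, h₁]) ≫ comp

/-- The reflexive graph underlies an internal category. -/
def ReflexiveGraph.IsInternalCategory (Γ : ReflexiveGraph C) : Prop :=
  Nonempty (InternalCategoryStructure Γ)

end Reflexive

variable {C : Type u} [Category.{v} C] [HasZeroMorphisms C] [HasFiniteLimits C]
  [HasFiniteColimits C]

/-! ### Binary and ternary co-smash products -/

/-- The comparison morphism `X + Y ⟶ X × Y`. -/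
def compare₂ (X Y : C) : X ⨿ Y ⟶ X ⨯ Y :=
  prod.lift (coprod.desc (𝟙 X) 0) (coprod.desc 0 (𝟙 Y))

/-- The co-smash product `X ⊗ Y`, the kernel of the comparison morphism. -/
def tensor₂ (X Y : C) : C := kernel (compare₂ X Y)

/-- The kernel morphism `X ⊗ Y ⟶ X + Y`. -/
def ι₂ (X Y : C) : tensor₂ X Y ⟶ X ⨿ Y := kernel.ι (compare₂ X Y)

/-- The comparison morphism `X + Y + Z ⟶ (X + Y) × (X + Z) × (Y + Z)`, whose components send
one of the three summands to zero. -/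
def compare₃ (X Y Z : C) : (X ⨿ Y) ⨿ Z ⟶ (X ⨿ Y) ⨯ ((X ⨿ Z) ⨯ (Y ⨿ Z)) :=
  prod.lift
    (coprod.desc (coprod.desc coprod.inl coprod.inr) 0)
    (prod.lift
      (coprod.desc (coprod.desc coprod.inl 0) coprod.inr)
      (coprod.desc (coprod.desc 0 coprod.inl) coprod.inr))

/-- The ternary co-smash product `X ⊗ Y ⊗ Z`, the kernel of the comparison morphism. -/
def tensor₃ (X Y Z : C) : C := kernel (compare₃ X Y Z)

/-- The kernel morphism `X ⊗ Y ⊗ Z ⟶ X + Y + Z`. -/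
def ι₃ (X Y Z : C) : tensor₃ X Y Z ⟶ (X ⨿ Y) ⨿ Z := kernel.ι (compare₃ X Y Z)

theorem ι₂_compare₂ (X Y : C) : ι₂ X Y ≫ compare₂ X Y = 0 := kernel.condition _

theorem ι₃_compare₃ (X Y Z : C) : ι₃ X Y Z ≫ compare₃ X Y Z = 0 := kernel.condition _

theorem ι₂_desc_left (X Y : C) : ι₂ X Y ≫ coprod.desc (𝟙 X) 0 = 0 := by
  have h : (ι₂ X Y ≫ compare₂ X Y) ≫ prod.fst = 0 := by rw [ι₂_compare₂, zero_comp]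
  simpa [compare₂] using h

theorem ι₂_desc_right (X Y : C) : ι₂ X Y ≫ coprod.desc 0 (𝟙 Y) = 0 := by
  have h : (ι₂ X Y ≫ compare₂ X Y) ≫ prod.snd = 0 := by rw [ι₂_compare₂, zero_comp]
  simpa [compare₂] using h

theorem ι₃_fst (X Y Z : C) :
    ι₃ X Y Z ≫ coprod.desc (coprod.desc coprod.inl coprod.inr) 0 = (0 : _ ⟶ X ⨿ Y) := by
  have h : (ι₃ X Y Z ≫ compare₃ X Y Z) ≫ prod.fst = 0 := by rw [ι₃_compare₃, zero_comp]
  simpa [compare₃] using h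

theorem ι₃_trd (X Y Z : C) :
    ι₃ X Y Z ≫ coprod.desc (coprod.desc 0 coprod.inl) coprod.inr = (0 : _ ⟶ Y ⨿ Z) := by
  have h : (ι₃ X Y Z ≫ compare₃ X Y Z) ≫ prod.snd ≫ prod.snd = 0 := by
    rw [ι₃_compare₃, zero_comp]
  simpa [compare₃] using h

/-- A morphism into `X + Y` killed by both retractions factors through `X ⊗ Y`. -/
def lift₂ {T X Y : C} (t : T ⟶ X ⨿ Y) (h₁ : t ≫ coprod.desc (𝟙 X) 0 = 0)
    (h₂ : t ≫ coprod.desc 0 (𝟙 Y) = 0) : T ⟶ tensor₂ X Y :=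
  kernel.lift (compare₂ X Y) t (by ext <;> simp [compare₂, h₁, h₂])

theorem lift₂_ι₂ {T X Y : C} (t : T ⟶ X ⨿ Y) (h₁ : t ≫ coprod.desc (𝟙 X) 0 = 0)
    (h₂ : t ≫ coprod.desc 0 (𝟙 Y) = 0) : lift₂ t h₁ h₂ ≫ ι₂ X Y = t :=
  kernel.lift_ι _ _ _

/-- The morphism `f ⊗ g`, induced by `f + g`. -/
def map₂ {X Y X' Y' : C} (f : X ⟶ X') (g : Y ⟶ Y') : tensor₂ X Y ⟶ tensor₂ X' Y' :=
  lift₂ (ι₂ X Y ≫ coprod.map f g)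
    (by
      have h := ι₂_desc_left X Y =≫ f
      have e : coprod.map f g ≫ coprod.desc (𝟙 X') 0 = coprod.desc (𝟙 X) 0 ≫ f := by
        ext <;> simp
      rw [Category.assoc, e]
      simpa using h)
    (by
      have h := ι₂_desc_right X Y =≫ g
      have e : coprod.map f g ≫ coprod.desc 0 (𝟙 Y') = coprod.desc 0 (𝟙 Y) ≫ g := by
        ext <;> simp
      rw [Category.assoc, e]
      simpa using h)

theorem map₂_ι₂ {X Y X' Y' : C} (f : X ⟶ X') (g : Y ⟶ Y') :
    map₂ f g ≫ ι₂ X' Y' = ι₂ X Y ≫ coprod.map f g :=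
  lift₂_ι₂ _ _ _

/-- The morphism `f ⊗ g ⊗ h`, induced by `f + g + h`. -/
def map₃ {X Y Z X' Y' Z' : C} (f : X ⟶ X') (g : Y ⟶ Y') (h : Z ⟶ Z') :
    tensor₃ X Y Z ⟶ tensor₃ X' Y' Z' :=
  kernel.map (compare₃ X Y Z) (compare₃ X' Y' Z') (coprod.map (coprod.map f g) h)
    (prod.map (coprod.map f g) (prod.map (coprod.map f h) (coprod.map g h)))
    (by ext <;> simp [compare₃])

/-- The folding operation `S_{1,2} : X ⊗ Y ⊗ Y ⟶ X ⊗ Y`, induced by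
`1 + ∇ : X + Y + Y ⟶ X + Y`. -/
def fold₁₂ (X Y : C) : tensor₃ X Y Y ⟶ tensor₂ X Y :=
  lift₂ (ι₃ X Y Y ≫ coprod.desc (coprod.desc coprod.inl coprod.inr) coprod.inr)
    (by
      have h := ι₃_fst X Y Y =≫ coprod.desc (𝟙 X) 0
      simpa using h)
    (by
      have h := ι₃_trd X Y Y =≫ coprod.desc (𝟙 Y) (𝟙 Y)
      simpa using h)

/-- The folding operation `S_{2,1} : X ⊗ X ⊗ Y ⟶ X ⊗ Y`, induced by
`∇ + 1 : X + X + Y ⟶ X + Y`. -/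
def fold₂₁ (X Y : C) : tensor₃ X X Y ⟶ tensor₂ X Y :=
  lift₂ (ι₃ X X Y ≫ coprod.desc (coprod.desc coprod.inl coprod.inl) coprod.inr)
    (by
      have h := ι₃_fst X X Y =≫ coprod.desc (𝟙 X) (𝟙 X)
      simpa using h)
    (by
      have h := ι₃_trd X X Y =≫ coprod.desc 0 (𝟙 Y)
      simpa using h)

/-! ### Actions, semi-direct products and conjugation -/

/-- The conjugation action `c^{X,X} : X ⊗ X ⟶ X`, that is, `∇` restricted to `X ⊗ X`. -/
def conj (X : C) : tensor₂ X X ⟶ X := ι₂ X X ≫ codiag X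

/-- The semi-direct product `A ⋊_ψ G`, the coequaliser of `ι_{A,G}` and `ι_A ∘ ψ`. -/
def semidirect {A G : C} (ψ : tensor₂ A G ⟶ A) : C :=
  coequalizer (ι₂ A G) (ψ ≫ coprod.inl)

/-- The quotient morphism `q : A + G ⟶ A ⋊_ψ G`. -/
def semidirectπ {A G : C} (ψ : tensor₂ A G ⟶ A) : A ⨿ G ⟶ semidirect ψ :=
  coequalizer.π (ι₂ A G) (ψ ≫ coprod.inl)

/-- The morphism `k_ψ = q ∘ ι_A`. -/
def semidirectK {A G : C} (ψ : tensor₂ A G ⟶ A) : A ⟶ semidirect ψ :=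
  coprod.inl ≫ semidirectπ ψ

/-- The morphism `s_ψ = q ∘ ι_G`. -/
def semidirectS {A G : C} (ψ : tensor₂ A G ⟶ A) : G ⟶ semidirect ψ :=
  coprod.inr ≫ semidirectπ ψ

/-- The morphism out of `A ⋊_ψ G` with components `f` on `A` and `g` on `G`, for `f` and `g`
compatible with `ψ`. -/
def semidirectDesc {A G Z : C} (ψ : tensor₂ A G ⟶ A) (f : A ⟶ Z) (g : G ⟶ Z)
    (h : map₂ f g ≫ conj Z = ψ ≫ f) : semidirect ψ ⟶ Z :=
  coequalizer.desc (coprod.desc f g) (by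
    have e : ι₂ A G ≫ coprod.desc f g = map₂ f g ≫ conj Z := by
      rw [conj, ← Category.assoc, map₂_ι₂]
      simp
    rw [e, h]
    simp)

/-- The morphism `p_ψ : A ⋊_ψ G ⟶ G` induced by the retraction `A + G ⟶ G`. -/
def semidirectP {A G : C} (ψ : tensor₂ A G ⟶ A) : semidirect ψ ⟶ G :=
  coequalizer.desc (coprod.desc 0 (𝟙 G)) (by
    rw [ι₂_desc_right]
    simp)

theorem semidirectπ_desc {A G Z : C} (ψ : tensor₂ A G ⟶ A) (f : A ⟶ Z) (g : G ⟶ Z)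
    (h : map₂ f g ≫ conj Z = ψ ≫ f) :
    semidirectπ ψ ≫ semidirectDesc ψ f g h = coprod.desc f g :=
  coequalizer.π_desc _ _

theorem semidirectπ_P {A G : C} (ψ : tensor₂ A G ⟶ A) :
    semidirectπ ψ ≫ semidirectP ψ = coprod.desc 0 (𝟙 G) :=
  coequalizer.π_desc _ _

/-- `ψ : A ⊗ G ⟶ A` determines an action of `G` on `A`: the morphism `k_ψ` is a monomorphism. -/
def IsAction {A G : C} (ψ : tensor₂ A G ⟶ A) : Prop := Mono (semidirectK ψ)

/-- The pullback `h^*(ψ) = ψ ∘ (1 ⊗ h)` of `ψ : A ⊗ G ⟶ A` along `h : H ⟶ G`. -/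
def actionPullback {A G H : C} (h : H ⟶ G) (ψ : tensor₂ A G ⟶ A) : tensor₂ A H ⟶ A :=
  map₂ (𝟙 A) h ≫ ψ

/-- The operation `ψ_{2,1} = ψ ∘ S_{2,1}` induced by `ψ`. -/
def op₂₁ {A G : C} (ψ : tensor₂ A G ⟶ A) : tensor₃ A A G ⟶ A := fold₂₁ A G ≫ ψ

/-- The operation `ψ_{1,2} = ψ ∘ S_{1,2}` induced by `ψ`. -/
def op₁₂ {A G : C} (ψ : tensor₂ A G ⟶ A) : tensor₃ A G G ⟶ A := fold₁₂ A G ≫ ψ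

/-! ### Precrossed and crossed modules -/

/-- A precrossed module `(G, A, μ, ∂)`. -/
structure PrecrossedModule (C : Type u) [Category.{v} C] [HasZeroMorphisms C]
    [HasFiniteLimits C] [HasFiniteColimits C] where
  G : C
  A : C
  μ : tensor₂ A G ⟶ A
  bd : A ⟶ G
  isAction : IsAction μ
  /-- `∂` is equivariant with respect to `μ` and the conjugation action of `G` on itself -/
  equivariant : map₂ bd (𝟙 G) ≫ conj G = μ ≫ bd

/-- The reflexive graph associated with a precrossed module: `R = A ⋊_μ G`, with `d = p_μ`,
`e = s_μ`, and with `c` determined by `c ∘ k_μ = ∂` and `c ∘ e = 1`. -/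
def PrecrossedModule.reflexiveGraph (M : PrecrossedModule C) : ReflexiveGraph C where
  R := semidirect M.μ
  G := M.G
  d := semidirectP M.μ
  c := semidirectDesc M.μ M.bd (𝟙 M.G) M.equivariant
  e := semidirectS M.μ
  e_d := by rw [semidirectS, Category.assoc, semidirectπ_P, coprod.inr_desc]
  e_c := by rw [semidirectS, Category.assoc, semidirectπ_desc, coprod.inr_desc]

/-- A precrossed module is a crossed module when its associated reflexive graph is an internal
category. -/
def PrecrossedModule.IsCrossedModule (M : PrecrossedModule C) : Prop :=
  M.reflexiveGraph.IsInternalCategory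

end CoSmash

end

noncomputable section

namespace CoSmash

attribute [local simp] prod.lift_fst prod.lift_snd prod.lift_fst_assoc prod.lift_snd_assoc
  coprod.inl_desc coprod.inr_desc coprod.inl_desc_assoc coprod.inr_desc_assoc
  pullback.lift_fst pullback.lift_snd pullback.lift_fst_assoc pullback.lift_snd_assoc

/-! ### Split extensions -/

/-! Write `R = A ⋊ G`, with `k : A ⟶ R` the kernel of the domain `d`. The object of composable pairs
is the pullback of `d` along the codomain `c`. It is therefore a split extension of `R` by `A`, and
its action is the pullback of `μ` along `c`. The kernel consists of the pairs `(k, 0)` and the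
section of the pairs `(id, α)`. Unitality forces a composition to be `k` on the former and the
identity on the latter. Since the middle object of a split extension is a semi-direct product
(`IsSplitExtension.exists_desc`), such a morphism exists exactly when conjugation of `R` on `A` is
the pullback of `μ` along `c`. The remaining axioms are then automatic, because kernel and section
of a split extension are jointly epic.

It remains to test this equality of actions. It may be restricted along the regular epimorphism `A +
G ⟶ R`, and `A ⊗ (A + G)` is jointly covered by `A ⊗ A`, `A ⊗ G` and `A ⊗ A ⊗ G`
(`tensor₂_coprod_hom_ext`). The first piece gives condition 1, the second holds by construction of
`R`, and the third gives condition 2. -/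

/-- `p` is split by `s` and `k` is a kernel of `p`. -/
structure IsSplitExtension {C : Type u} [Category.{v} C] [HasZeroMorphisms C] {A X B : C}
    (k : A ⟶ X) (p : X ⟶ B) (s : B ⟶ X) : Prop where
  mono : Mono k
  k_p : k ≫ p = 0
  s_p : s ≫ p = 𝟙 B
  exists_lift : ∀ {T : C} (t : T ⟶ X), t ≫ p = 0 → ∃ l, l ≫ k = t

namespace IsSplitExtension

section Basic

variable {C : Type u} [Category.{v} C] [HasZeroMorphisms C]

theorem of_kernel {X B : C} (p : X ⟶ B) [HasKernel p] (s : B ⟶ X) (h : s ≫ p = 𝟙 B) :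
    IsSplitExtension (kernel.ι p) p s where
  mono := inferInstance
  k_p := kernel.condition p
  s_p := h
  exists_lift t ht := ⟨kernel.lift p t ht, kernel.lift_ι _ _ _⟩

theorem pullback [HasPullbacks C] {A X B B' : C} {k : A ⟶ X} {p : X ⟶ B} {s : B ⟶ X}
    (E : IsSplitExtension k p s) (g : B' ⟶ B) :
    IsSplitExtension (pullback.lift k 0 (by simp [E.k_p]) : A ⟶ pullback p g) (pullback.snd p g)
      (pullback.lift (g ≫ s) (𝟙 B') (by simp [E.s_p])) where
  mono := by
    have : Mono ((pullback.lift k 0 (by simp [E.k_p]) : A ⟶ Limits.pullback p g) ≫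
        pullback.fst p g) := by
      rw [pullback.lift_fst]; exact E.mono
    exact mono_of_mono _ (pullback.fst p g)
  k_p := by simp
  s_p := by simp
  exists_lift t ht := by
    obtain ⟨l, hl⟩ := E.exists_lift (t ≫ pullback.fst p g) (by
      rw [Category.assoc, pullback.condition, reassoc_of% ht, zero_comp])
    refine ⟨l, ?_⟩
    apply pullback.hom_ext <;> simp [hl, ht]

end Basic

variable {C : Type u} [Category.{v} C] [HasZeroObject C] [HasZeroMorphisms C] [Homological C]

/-- The kernel and the section of a split extension are jointly extremally epic. -/
theorem isIso_of_mono {A X B M : C} {k : A ⟶ X} {p : X ⟶ B} {s : B ⟶ X}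
    (E : IsSplitExtension k p s) (m : M ⟶ X) [Mono m] (k' : A ⟶ M) (s' : B ⟶ M)
    (hk : k' ≫ m = k) (hs : s' ≫ m = s) : IsIso m := by
  have hp : (m ≫ p) ≫ 𝟙 B = m ≫ p := Category.comp_id _
  refine Protomodular.splitShortFive (m ≫ p) s' p s m (𝟙 B) (by rw [reassoc_of% hs, E.s_p]) E.s_p
    hp (by rw [hs, Category.id_comp]) ?_ inferInstance
  -- Since `k` is a kernel of `p` and factors through `m`, lifting along `k` and then applying `k'`
  -- inverts the comparison of kernels.
  obtain ⟨l, hl⟩ := E.exists_lift (kernel.ι p) (kernel.condition p)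
  have hι : kernel.map (m ≫ p) p m (𝟙 B) hp ≫ kernel.ι p = kernel.ι (m ≫ p) ≫ m :=
    kernel.lift_ι _ _ _
  have hlk : (l ≫ k') ≫ m = kernel.ι p := by rw [Category.assoc, hk, hl]
  have hr : kernel.lift (m ≫ p) (l ≫ k') (by rw [← Category.assoc, hlk, kernel.condition]) ≫
      kernel.map (m ≫ p) p m (𝟙 B) hp = 𝟙 _ := by
    rw [← cancel_mono (kernel.ι p), Category.assoc, hι, kernel.lift_ι_assoc, hlk,
      Category.id_comp]
  refine ⟨_, ?_, hr⟩
  rw [← cancel_mono (kernel.ι (m ≫ p)), ← cancel_mono m]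
  simp only [Category.assoc, kernel.lift_ι_assoc, Category.id_comp]
  rw [hk, hl, hι]

/-- The pullback of `m` along `f` is a subobject of `X` containing both `k` and `s`, hence all of
`X`. -/
theorem factors_through_mono {A X B Z M : C} {k : A ⟶ X} {p : X ⟶ B} {s : B ⟶ X}
    (E : IsSplitExtension k p s) (f : X ⟶ Z) (m : M ⟶ Z) [Mono m] (a : A ⟶ M) (b : B ⟶ M)
    (ha : k ≫ f = a ≫ m) (hb : s ≫ f = b ≫ m) : ∃ g : X ⟶ M, g ≫ m = f := by
  have := E.isIso_of_mono (pullback.fst f m) (pullback.lift k a ha) (pullback.lift s b hb)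
    (by simp) (by simp)
  exact ⟨inv (pullback.fst f m) ≫ pullback.snd f m, by
    rw [Category.assoc, ← pullback.condition, IsIso.inv_hom_id_assoc]⟩

/-- The equalizer of `f` and `g` is a subobject of `X` containing both `k` and `s`. -/
theorem hom_ext {A X B Z : C} {k : A ⟶ X} {p : X ⟶ B} {s : B ⟶ X}
    (E : IsSplitExtension k p s) {f g : X ⟶ Z} (hk : k ≫ f = k ≫ g) (hs : s ≫ f = s ≫ g) :
    f = g := by
  have := E.isIso_of_mono (equalizer.ι f g) (equalizer.lift k hk) (equalizer.lift s hs)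
    (equalizer.lift_ι _ _) (equalizer.lift_ι _ _)
  rw [← cancel_epi (equalizer.ι f g), equalizer.condition]

theorem isRegularEpi_desc [HasFiniteColimits C] {A X B : C} {k : A ⟶ X} {p : X ⟶ B} {s : B ⟶ X}
    (E : IsSplitExtension k p s) : IsRegularEpi (coprod.desc k s) := by
  have : Epi (coprod.desc k s) := ⟨fun f g h => E.hom_ext
    (by simpa using coprod.inl ≫= h) (by simpa using coprod.inr ≫= h)⟩
  have : ExtremalEpi (coprod.desc k s) :=
    { isIso := fun r i h _ => E.isIso_of_mono i (coprod.inl ≫ r) (coprod.inr ≫ r)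
        (by simp [h]) (by simp [h]) }
  infer_instance

end IsSplitExtension

section

variable {C : Type u} [Category.{v} C] [HasZeroObject C] [HasZeroMorphisms C] [Homological C]

/-- Every regular epimorphism is a cokernel of its kernel. -/
theorem exists_desc_of_isRegularEpi {X Y Z : C} (f : X ⟶ Y) [IsRegularEpi f] (g : X ⟶ Z)
    (h : kernel.ι f ≫ g = 0) : ∃ t : Y ⟶ Z, f ≫ t = g := by
  -- The first projection of the kernel pair is split by the diagonal, with kernel `(0, ker f)`.
  -- Equality of the two projections followed by `g` thus need only be tested on the kernel, where
  -- it is the hypothesis, and on the diagonal, where it is trivial.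
  have E : IsSplitExtension
      (pullback.lift 0 (kernel.ι f) (by simp) : kernel f ⟶ pullback f f)
      (pullback.fst f f) (pullback.lift (𝟙 X) (𝟙 X) rfl) :=
    { mono := by
        have : Mono ((pullback.lift 0 (kernel.ι f) (by simp) : kernel f ⟶ pullback f f) ≫
            pullback.snd f f) := by
          rw [pullback.lift_snd]; infer_instance
        exact mono_of_mono _ (pullback.snd f f)
      k_p := by simp
      s_p := by simp
      exists_lift := fun t ht => by
        refine ⟨kernel.lift f (t ≫ pullback.snd f f) (by
          rw [Category.assoc, ← pullback.condition, reassoc_of% ht, zero_comp]), ?_⟩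
        apply pullback.hom_ext <;> simp [ht] }
  have e : pullback.fst f f ≫ g = pullback.snd f f ≫ g := E.hom_ext (by simp [h]) (by simp)
  refine ⟨IsRegularEpi.desc f g ?_, IsRegularEpi.fac f g _⟩
  have e' := pullback.lift _ _ (IsRegularEpi.w f) ≫= e
  simpa using e'

/-- A composition with the correct values on the kernel of the domain morphism and on the pairs
whose first component is an identity is part of an internal category structure. -/
theorem ReflexiveGraph.isInternalCategory_of_comp {Γ : ReflexiveGraph C} {A : C} {k : A ⟶ Γ.R}
    (E : IsSplitExtension k Γ.d Γ.e)
    (m : pullback Γ.d Γ.c ⟶ Γ.R)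
    (hm₁ : pullback.lift k 0 (by simp [E.k_p]) ≫ m = k)
    (hm₂ : pullback.lift (Γ.c ≫ Γ.e) (𝟙 Γ.R) (by simp [Γ.e_d]) ≫ m = 𝟙 Γ.R) :
    Γ.IsInternalCategory := by
  have hd : m ≫ Γ.d = pullback.snd Γ.d Γ.c ≫ Γ.d := by
    refine (E.pullback Γ.c).hom_ext ?_ ?_
    · rw [reassoc_of% hm₁]; simp [E.k_p]
    · rw [reassoc_of% hm₂]; simp
  have hc : m ≫ Γ.c = pullback.fst Γ.d Γ.c ≫ Γ.c := by
    refine (E.pullback Γ.c).hom_ext ?_ ?_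
    · rw [reassoc_of% hm₁]; simp
    · rw [reassoc_of% hm₂]; simp [Γ.e_c]
  -- Precomposing a composite of generalized elements with `t` composes their restrictions along
  -- `t`.
  have comp_lift : ∀ {T T' : C} (t : T' ⟶ T) (a b : T ⟶ Γ.R) (w : a ≫ Γ.d = b ≫ Γ.c)
      (a' b' : T' ⟶ Γ.R) (w' : a' ≫ Γ.d = b' ≫ Γ.c) (_ : t ≫ a = a') (_ : t ≫ b = b'),
      t ≫ pullback.lift a b w ≫ m = pullback.lift a' b' w' ≫ m := by
    rintro T T' t a b w _ _ w' rfl rfl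
    rw [← Category.assoc]
    congr 1
    apply pullback.hom_ext <;> simp
  have lift_id : ∀ {T : C} (a b : T ⟶ Γ.R) (w : a ≫ Γ.d = b ≫ Γ.c) (_ : a = b ≫ Γ.c ≫ Γ.e),
      pullback.lift a b w ≫ m = b := by
    rintro T _ b w rfl
    exact (comp_lift b _ _ _ _ _ w rfl (Category.comp_id b)).symm.trans
      ((b ≫= hm₂).trans (Category.comp_id b))
  refine ⟨⟨m, hd, hc, ?_, hm₂, ?_⟩⟩
  · refine E.hom_ext ?_ ?_
    · refine (comp_lift k _ _ _ k 0 (by simp [E.k_p]) (Category.comp_id k)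
        (by rw [reassoc_of% E.k_p, zero_comp])).trans (hm₁.trans (Category.comp_id k).symm)
    · refine (comp_lift Γ.e _ _ _ Γ.e Γ.e (by rw [Γ.e_d, Γ.e_c]) (Category.comp_id _)
        (by rw [reassoc_of% Γ.e_d])).trans
        ((lift_id _ _ _ (by rw [reassoc_of% Γ.e_c])).trans (Category.comp_id _).symm)
  · intro T γ β α h₁ h₂
    -- Associativity is proved for the universal composable triple `(γ, (β, α))`. The object of
    -- triples is the pullback of `d` along `f ≫ c`, so it suffices to check the triples `(k, 0,
    -- 0)`, where both sides are `k`, and those with `γ` an identity, where both sides are `β ∘ α`.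
    let f := pullback.fst Γ.d Γ.c
    let g := pullback.snd Γ.d Γ.c
    let γ₀ := pullback.fst Γ.d (f ≫ Γ.c)
    let π := pullback.snd Γ.d (f ≫ Γ.c)
    have w₁ : γ₀ ≫ Γ.d = (π ≫ f) ≫ Γ.c := by
      rw [Category.assoc]; exact pullback.condition
    have w₃ : (pullback.lift γ₀ (π ≫ f) w₁ ≫ m) ≫ Γ.d = (π ≫ g) ≫ Γ.c := by
      rw [Category.assoc, hd, pullback.lift_snd_assoc, Category.assoc, Category.assoc,
        pullback.condition]
    have w₄ : γ₀ ≫ Γ.d = (π ≫ m) ≫ Γ.c := by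
      rw [Category.assoc, hc, w₁, Category.assoc]
    have key : pullback.lift (pullback.lift γ₀ (π ≫ f) w₁ ≫ m) (π ≫ g) w₃ ≫ m =
        pullback.lift γ₀ (π ≫ m) w₄ ≫ m := by
      refine (E.pullback (f ≫ Γ.c)).hom_ext ?_ ?_
      · refine (comp_lift _ _ _ _ k 0 (by simp [E.k_p]) ?_ (by simp [π])).trans
          (comp_lift _ _ _ _ k 0 (by simp [E.k_p]) (by simp [γ₀]) (by simp [π])).symm
        exact (comp_lift _ _ _ _ k 0 (by simp [E.k_p]) (by simp [γ₀]) (by simp [π])).trans hm₁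
      · refine (comp_lift _ _ _ _ f g pullback.condition ?_ (by simp [π])).trans
          (Eq.trans ?_ (comp_lift _ _ _ _ (m ≫ Γ.c ≫ Γ.e) m (by simp [Γ.e_d])
            (by simp [γ₀, reassoc_of% hc, f]) (by simp [π])).symm)
        · exact (comp_lift _ _ _ _ (f ≫ Γ.c ≫ Γ.e) f (by simp [Γ.e_d]) (by simp [γ₀])
            (by simp [π])).trans (lift_id _ _ _ rfl)
        · have e : pullback.lift f g pullback.condition = 𝟙 _ := by
            apply pullback.hom_ext <;> simp [f, g]
          rw [e, Category.id_comp, lift_id _ _ _ rfl]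
    let t : T ⟶ pullback Γ.d (f ≫ Γ.c) :=
      pullback.lift γ (pullback.lift β α h₂) (by simp [f, h₁])
    have hπ : t ≫ π = pullback.lift β α h₂ := pullback.lift_snd _ _ _
    refine (comp_lift t _ _ _ _ _ _ ?_ ?_).symm.trans ((t ≫= key).trans
      (comp_lift t _ _ _ _ _ _ ?_ ?_))
    · exact comp_lift t _ _ _ _ _ _ (pullback.lift_fst _ _ _)
        (by rw [reassoc_of% hπ, pullback.lift_fst])
    · rw [reassoc_of% hπ, pullback.lift_snd]
    · exact pullback.lift_fst _ _ _
    · rw [reassoc_of% hπ]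

variable [HasFiniteColimits C]

/-! ### Co-smash products -/

theorem map₂_comp {X Y X' Y' X'' Y'' : C} (f : X ⟶ X') (g : Y ⟶ Y') (f' : X' ⟶ X'')
    (g' : Y' ⟶ Y'') : map₂ f g ≫ map₂ f' g' = map₂ (f ≫ f') (g ≫ g') := by
  have : Mono (ι₂ X'' Y'') := inferInstanceAs (Mono (kernel.ι _))
  rw [← cancel_mono (ι₂ X'' Y''), Category.assoc, map₂_ι₂, reassoc_of% map₂_ι₂ f g, map₂_ι₂]
  simp

theorem map₂_id (X Y : C) : map₂ (𝟙 X) (𝟙 Y) = 𝟙 (tensor₂ X Y) := by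
  have : Mono (ι₂ X Y) := inferInstanceAs (Mono (kernel.ι _))
  rw [← cancel_mono (ι₂ X Y), map₂_ι₂]
  simp

theorem map₂_zero_right {X X' : C} (Y Y' : C) (f : X ⟶ X') :
    map₂ f (0 : Y ⟶ Y') = 0 := by
  have : Mono (ι₂ X' Y') := inferInstanceAs (Mono (kernel.ι _))
  rw [← cancel_mono (ι₂ X' Y'), map₂_ι₂, zero_comp]
  have e : coprod.map f (0 : Y ⟶ Y') = coprod.desc (𝟙 X) 0 ≫ f ≫ coprod.inl := by
    ext <;> simp
  rw [e, ← Category.assoc, ι₂_desc_left, zero_comp]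

/-- The kernel of the retraction `X + Y ⟶ Y` is a split extension of `X` by `X ⊗ Y`. -/
theorem isSplitExtension_kernel_desc (X Y : C) :
    IsSplitExtension
      (kernel.lift (coprod.desc 0 (𝟙 Y)) (ι₂ X Y) (ι₂_desc_right X Y))
      (kernel.ι (coprod.desc (0 : X ⟶ Y) (𝟙 Y)) ≫ coprod.desc (𝟙 X) 0)
      (kernel.lift (coprod.desc 0 (𝟙 Y)) coprod.inl (by simp)) where
  mono := by
    have : Mono (kernel.lift (coprod.desc 0 (𝟙 Y)) (ι₂ X Y) (ι₂_desc_right X Y) ≫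
        kernel.ι (coprod.desc (0 : X ⟶ Y) (𝟙 Y))) := by
      rw [kernel.lift_ι]; exact inferInstanceAs (Mono (kernel.ι _))
    exact mono_of_mono _ (kernel.ι (coprod.desc (0 : X ⟶ Y) (𝟙 Y)))
  k_p := by rw [kernel.lift_ι_assoc, ι₂_desc_left]
  s_p := by simp
  exists_lift t ht := by
    refine ⟨lift₂ (t ≫ kernel.ι (coprod.desc (0 : X ⟶ Y) (𝟙 Y))) (by simpa using ht) (by simp), ?_⟩
    rw [← cancel_mono (kernel.ι _), Category.assoc, kernel.lift_ι, lift₂_ι₂]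

/-- The middle object of a split extension is the semi-direct product for the corresponding
action. -/
theorem IsSplitExtension.exists_desc {A X B Z : C} {k : A ⟶ X} {p : X ⟶ B} {s : B ⟶ X}
    (E : IsSplitExtension k p s) (ψ : tensor₂ A B ⟶ A)
    (hψ : ι₂ A B ≫ coprod.desc k s = ψ ≫ k) (f : A ⟶ Z) (g : B ⟶ Z)
    (h : ι₂ A B ≫ coprod.desc f g = ψ ≫ f) : ∃ t : X ⟶ Z, k ≫ t = f ∧ s ≫ t = g := by
  have := E.mono
  have hp : coprod.desc k s ≫ p = coprod.desc 0 (𝟙 B) := by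
    ext <;> simp [E.k_p, E.s_p]
  -- `ρ` is the restriction of `[k, s]` to the kernels of `A + B ⟶ B` and `p`. It is `ψ` on `A ⊗ B`
  -- and the identity on `A`, so `[f, g]` agrees with `ρ ≫ f` there. As the kernel of `[k, s]` lies
  -- in this subobject and is killed by `ρ`, it is killed by `[f, g]`.
  obtain ⟨ρ, hρ⟩ := E.exists_lift (kernel.ι (coprod.desc (0 : A ⟶ B) (𝟙 B)) ≫ coprod.desc k s)
    (by rw [Category.assoc, hp, kernel.condition])
  have e : kernel.ι (coprod.desc (0 : A ⟶ B) (𝟙 B)) ≫ coprod.desc f g = ρ ≫ f := by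
    refine (isSplitExtension_kernel_desc A B).hom_ext ?_ ?_
    · have e₁ : kernel.lift (coprod.desc 0 (𝟙 B)) (ι₂ A B) (ι₂_desc_right A B) ≫ ρ = ψ := by
        rw [← cancel_mono k, Category.assoc, hρ, kernel.lift_ι_assoc, hψ]
      rw [kernel.lift_ι_assoc, h, reassoc_of% e₁]
    · have e₂ : kernel.lift (coprod.desc 0 (𝟙 B)) coprod.inl (by simp) ≫ ρ = 𝟙 A := by
        rw [← cancel_mono k, Category.assoc, hρ, kernel.lift_ι_assoc]
        simp
      rw [kernel.lift_ι_assoc, reassoc_of% e₂, coprod.inl_desc]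
  have := E.isRegularEpi_desc
  obtain ⟨t, ht⟩ := exists_desc_of_isRegularEpi (coprod.desc k s) (coprod.desc f g) (by
    have h₀ : kernel.ι (coprod.desc k s) ≫ coprod.desc (0 : A ⟶ B) (𝟙 B) = 0 := by
      rw [← hp, kernel.condition_assoc, zero_comp]
    have h₁ : kernel.lift _ _ h₀ ≫ ρ = 0 := by
      rw [← cancel_mono k, Category.assoc, hρ, kernel.lift_ι_assoc, kernel.condition, zero_comp]
    rw [← kernel.lift_ι _ _ h₀, Category.assoc, e, reassoc_of% h₁, zero_comp])
  exact ⟨t, by simpa using coprod.inl ≫= ht, by simpa using coprod.inr ≫= ht⟩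

/-- The morphism `A ⊗ X ⊗ Y ⟶ A ⊗ (X + Y)` induced by associativity of the coproduct. -/
def assocCoprod (A X Y : C) : tensor₃ A X Y ⟶ tensor₂ A (X ⨿ Y) :=
  lift₂ (ι₃ A X Y ≫ coprod.desc (coprod.desc coprod.inl (coprod.inl ≫ coprod.inr))
      (coprod.inr ≫ coprod.inr))
    (by
      have h := ι₃_fst A X Y =≫ coprod.desc (𝟙 A) 0
      simpa using h)
    (by
      have h := ι₃_trd A X Y
      have e : coprod.desc (coprod.desc coprod.inl (coprod.inl ≫ coprod.inr))
          (coprod.inr ≫ coprod.inr) ≫ coprod.desc (0 : A ⟶ X ⨿ Y) (𝟙 _) =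
          coprod.desc (coprod.desc 0 coprod.inl) coprod.inr := by
        ext <;> simp
      rw [Category.assoc, e, h])

theorem assocCoprod_ι₂ (A X Y : C) : assocCoprod A X Y ≫ ι₂ A (X ⨿ Y) =
    ι₃ A X Y ≫ coprod.desc (coprod.desc coprod.inl (coprod.inl ≫ coprod.inr))
      (coprod.inr ≫ coprod.inr) :=
  lift₂_ι₂ _ _ _

/-- The two hypotheses give the components of `compare₃` that omit `Y` and `X`; the one omitting `A`
vanishes on all of `A ⊗ (X + Y)`. -/
theorem exists_lift_assocCoprod {T A X Y : C} (t : T ⟶ tensor₂ A (X ⨿ Y))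
    (h₁ : t ≫ map₂ (𝟙 A) (coprod.desc (𝟙 X) 0) = 0)
    (h₂ : t ≫ map₂ (𝟙 A) (coprod.desc 0 (𝟙 Y)) = 0) :
    ∃ l, l ≫ assocCoprod A X Y = t := by
  have : Mono (ι₂ A (X ⨿ Y)) := inferInstanceAs (Mono (kernel.ι _))
  have e₁ := h₁ =≫ ι₂ A X
  have e₂ := h₂ =≫ ι₂ A Y
  rw [Category.assoc, map₂_ι₂, zero_comp] at e₁ e₂
  have e₃ := t ≫= ι₂_desc_right A (X ⨿ Y)
  rw [comp_zero] at e₃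
  let α : A ⨿ (X ⨿ Y) ⟶ (A ⨿ X) ⨿ Y :=
    coprod.desc (coprod.inl ≫ coprod.inl) (coprod.desc (coprod.inr ≫ coprod.inl) coprod.inr)
  have a₁ : α ≫ coprod.desc (coprod.desc coprod.inl coprod.inr) 0 =
      coprod.map (𝟙 A) (coprod.desc (𝟙 X) 0) := by ext <;> simp [α]
  have a₂ : α ≫ coprod.desc (coprod.desc coprod.inl 0) coprod.inr =
      coprod.map (𝟙 A) (coprod.desc 0 (𝟙 Y)) := by ext <;> simp [α]
  have a₃ : α ≫ coprod.desc (coprod.desc 0 coprod.inl) coprod.inr =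
      coprod.desc (0 : A ⟶ X ⨿ Y) (𝟙 _) := by ext <;> simp [α]
  have a₄ : α ≫ coprod.desc (coprod.desc coprod.inl (coprod.inl ≫ coprod.inr))
      (coprod.inr ≫ coprod.inr) = 𝟙 _ := by ext <;> simp [α]
  have hc : (t ≫ ι₂ A (X ⨿ Y) ≫ α) ≫ compare₃ A X Y = 0 := by
    unfold compare₃
    apply Limits.prod.hom_ext
    · simp only [Category.assoc, prod.lift_fst, zero_comp, a₁, e₁]
    · apply Limits.prod.hom_ext
      · simp only [Category.assoc, prod.lift_fst, prod.lift_snd, zero_comp, a₂, e₂]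
      · simp only [Category.assoc, prod.lift_snd, zero_comp, a₃, e₃]
  obtain ⟨l, hl⟩ : ∃ l, l ≫ ι₃ A X Y = t ≫ ι₂ A (X ⨿ Y) ≫ α :=
    ⟨kernel.lift _ _ hc, kernel.lift_ι _ _ _⟩
  refine ⟨l, ?_⟩
  rw [← cancel_mono (ι₂ A (X ⨿ Y)), Category.assoc, assocCoprod_ι₂, reassoc_of% hl]
  simp only [a₄, Category.comp_id]

/-- `A ⊗ X`, `A ⊗ Y` and `A ⊗ X ⊗ Y` jointly cover `A ⊗ (X + Y)`. -/
theorem tensor₂_coprod_hom_ext {A X Y Z : C} {f g : tensor₂ A (X ⨿ Y) ⟶ Z}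
    (h₁ : map₂ (𝟙 A) coprod.inl ≫ f = map₂ (𝟙 A) coprod.inl ≫ g)
    (h₂ : map₂ (𝟙 A) coprod.inr ≫ f = map₂ (𝟙 A) coprod.inr ≫ g)
    (h₃ : assocCoprod A X Y ≫ f = assocCoprod A X Y ≫ g) : f = g := by
  let p₂ : tensor₂ A (X ⨿ Y) ⟶ tensor₂ A Y := map₂ (𝟙 A) (coprod.desc 0 (𝟙 Y))
  let p₁ : tensor₂ A (X ⨿ Y) ⟶ tensor₂ A X := map₂ (𝟙 A) (coprod.desc (𝟙 X) 0)
  have s₂ : map₂ (𝟙 A) coprod.inr ≫ p₂ = 𝟙 _ := by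
    rw [map₂_comp, coprod.inr_desc, Category.comp_id, map₂_id]
  have s₁ : map₂ (𝟙 A) coprod.inl ≫ p₁ = 𝟙 _ := by
    rw [map₂_comp, coprod.inl_desc, Category.comp_id, map₂_id]
  have s₁₂ : map₂ (𝟙 A) coprod.inl ≫ p₂ = 0 := by
    rw [map₂_comp, coprod.inl_desc, map₂_zero_right]
  -- Two nested split extensions: `A ⊗ (X + Y)` over `A ⊗ Y`, then the kernel over `A ⊗ X`. The last
  -- kernel factors through `A ⊗ X ⊗ Y`.
  refine (IsSplitExtension.of_kernel p₂ _ s₂).hom_ext ?_ h₂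
  refine (IsSplitExtension.of_kernel (kernel.ι p₂ ≫ p₁) (kernel.lift p₂ _ s₁₂)
    (by rw [kernel.lift_ι_assoc, s₁])).hom_ext ?_ ?_
  · obtain ⟨l, hl⟩ := exists_lift_assocCoprod (kernel.ι (kernel.ι p₂ ≫ p₁) ≫ kernel.ι p₂)
      ((Category.assoc _ _ _).trans (kernel.condition (kernel.ι p₂ ≫ p₁)))
      (by rw [Category.assoc, kernel.condition, comp_zero])
    rw [← Category.assoc, ← Category.assoc, ← hl, Category.assoc, Category.assoc, h₃]
  · rw [kernel.lift_ι_assoc, kernel.lift_ι_assoc, h₁]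

/-! ### Semi-direct products -/

theorem ι₂_semidirectπ {A G : C} (ψ : tensor₂ A G ⟶ A) :
    ι₂ A G ≫ semidirectπ ψ = ψ ≫ semidirectK ψ := by
  rw [semidirectK, ← Category.assoc]
  exact coequalizer.condition _ _

theorem desc_semidirectK_semidirectS {A G : C} (ψ : tensor₂ A G ⟶ A) :
    coprod.desc (semidirectK ψ) (semidirectS ψ) = semidirectπ ψ := by
  ext <;> simp [semidirectK, semidirectS]

/-- The kernel of `A + G ⟶ G` is covered by `A ⊗ G` and `A`, so its image in `A ⋊ G` lies in the
subobject `A`. Pulling the quotient morphism back along the kernel of `semidirectP ψ` shows that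
this kernel is covered by the same image, so the inclusion of `A` into it is a strong epimorphism as
well as a monomorphism. -/
theorem IsAction.isSplitExtension {A G : C} {ψ : tensor₂ A G ⟶ A} (h : IsAction ψ) :
    IsSplitExtension (semidirectK ψ) (semidirectP ψ) (semidirectS ψ) := by
  have : Mono (semidirectK ψ) := h
  have hkp : semidirectK ψ ≫ semidirectP ψ = 0 := by
    rw [semidirectK, Category.assoc, semidirectπ_P, coprod.inl_desc]
  refine ⟨h, hkp, by rw [semidirectS, Category.assoc, semidirectπ_P, coprod.inr_desc],
    fun t ht => ?_⟩
  obtain ⟨ρ, hρ⟩ := (isSplitExtension_kernel_desc A G).factors_through_mono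
    (kernel.ι (coprod.desc 0 (𝟙 G)) ≫ semidirectπ ψ) (semidirectK ψ) ψ (𝟙 A)
    (by rw [kernel.lift_ι_assoc, ι₂_semidirectπ])
    (by rw [kernel.lift_ι_assoc, Category.id_comp, semidirectK])
  have : IsRegularEpi (semidirectπ ψ) := inferInstanceAs (IsRegularEpi (coequalizer.π _ _))
  let j := kernel.ι (semidirectP ψ)
  let w := kernel.lift (coprod.desc 0 (𝟙 G)) (pullback.fst (semidirectπ ψ) j) (by
    rw [← semidirectπ_P ψ, ← Category.assoc, pullback.condition, Category.assoc,
      kernel.condition, comp_zero])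
  let k' := kernel.lift (semidirectP ψ) (semidirectK ψ) hkp
  have hk' : k' ≫ j = semidirectK ψ := kernel.lift_ι _ _ _
  have hw : (w ≫ ρ) ≫ k' = pullback.snd (semidirectπ ψ) j := by
    rw [← cancel_mono j, Category.assoc, hk', Category.assoc, hρ, kernel.lift_ι_assoc,
      pullback.condition]
  have : Mono (k' ≫ j) := by rw [hk']; exact h
  have : Mono k' := mono_of_mono k' j
  have : StrongEpi ((w ≫ ρ) ≫ k') := by rw [hw]; infer_instance
  have : StrongEpi k' := strongEpi_of_strongEpi (w ≫ ρ) k'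
  have : IsIso k' := isIso_of_mono_of_strongEpi k'
  refine ⟨kernel.lift _ t ht ≫ inv k', ?_⟩
  rw [← hk', Category.assoc, IsIso.inv_hom_id_assoc, kernel.lift_ι]

/-- If `ψ` is the conjugation action of a split extension, then the conjugation action of the
pullback of this extension along `t` is the pullback of `ψ` along `t`. -/
theorem IsSplitExtension.ι₂_desc_pullback_lift {A X G T : C} {k : A ⟶ X} {p : X ⟶ G} {s : G ⟶ X}
    (E : IsSplitExtension k p s) {ψ : tensor₂ A G ⟶ A}
    (hψ : ι₂ A G ≫ coprod.desc k s = ψ ≫ k) (t : T ⟶ G) :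
    ι₂ A T ≫ coprod.desc (pullback.lift k 0 (by simp [E.k_p]))
        (pullback.lift (t ≫ s) (𝟙 T) (by simp [E.s_p])) =
      actionPullback t ψ ≫ (pullback.lift k 0 (by simp [E.k_p]) : A ⟶ Limits.pullback p t) := by
  apply pullback.hom_ext
  · have e : coprod.desc (pullback.lift k 0 (by simp [E.k_p]))
        (pullback.lift (t ≫ s) (𝟙 T) (by simp [E.s_p])) ≫ pullback.fst p t =
        coprod.map (𝟙 A) t ≫ coprod.desc k s := by
      ext <;> simp
    rw [Category.assoc, e, ← Category.assoc, ← map₂_ι₂, Category.assoc, hψ,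
      Category.assoc, pullback.lift_fst, actionPullback, Category.assoc]
  · have e : coprod.desc (pullback.lift k 0 (by simp [E.k_p]))
        (pullback.lift (t ≫ s) (𝟙 T) (by simp [E.s_p])) ≫ pullback.snd p t =
        coprod.desc 0 (𝟙 T) := by
      ext <;> simp
    rw [Category.assoc, e, ι₂_desc_right, Category.assoc, pullback.lift_snd, comp_zero]

/-- Both copies of `A` are sent to `A ⋊ G` by `semidirectK ψ`, so conjugation on the ternary piece
factors through the folding of the two copies. -/
theorem assocCoprod_ι₂_desc {A G : C} (ψ : tensor₂ A G ⟶ A) :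
    assocCoprod A A G ≫ ι₂ A (A ⨿ G) ≫ coprod.desc (semidirectK ψ) (semidirectπ ψ) =
      op₂₁ ψ ≫ semidirectK ψ := by
  rw [op₂₁, Category.assoc, ← ι₂_semidirectπ, fold₂₁, ← Category.assoc (lift₂ _ _ _), lift₂_ι₂,
    ← Category.assoc, assocCoprod_ι₂, Category.assoc, Category.assoc]
  congr 1
  ext <;> simp [semidirectK]

theorem map₃_fold₁₂ {A X G : C} (f : X ⟶ G) :
    map₃ (𝟙 A) f (𝟙 G) ≫ fold₁₂ A G =
      assocCoprod A X G ≫ map₂ (𝟙 A) (coprod.desc f (𝟙 G)) := by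
  have : Mono (ι₂ A G) := inferInstanceAs (Mono (kernel.ι _))
  have e : map₃ (𝟙 A) f (𝟙 G) ≫ ι₃ A G G =
      ι₃ A X G ≫ coprod.map (coprod.map (𝟙 A) f) (𝟙 G) := kernel.lift_ι _ _ _
  rw [← cancel_mono (ι₂ A G), Category.assoc, Category.assoc, map₂_ι₂, fold₁₂, lift₂_ι₂,
    ← Category.assoc, ← Category.assoc, e, assocCoprod_ι₂, Category.assoc, Category.assoc]
  congr 1
  ext <;> simp

/-- Identifies the right-hand side of condition 2, for `f = ∂`, as the ternary part of the
pulled-back action. -/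
theorem map₃_op₁₂ {A X G : C} (ψ : tensor₂ A G ⟶ A) (f : X ⟶ G) :
    map₃ (𝟙 A) f (𝟙 G) ≫ op₁₂ ψ =
      assocCoprod A X G ≫ actionPullback (coprod.desc f (𝟙 G)) ψ := by
  rw [op₁₂, ← Category.assoc, map₃_fold₁₂, actionPullback, Category.assoc]

theorem map₂_ι₂_desc {A G X : C} {Z : C} (f : A ⟶ Z) (g : G ⟶ Z) (t : X ⟶ G) :
    map₂ (𝟙 A) t ≫ ι₂ A G ≫ coprod.desc f g = ι₂ A X ≫ coprod.desc f (t ≫ g) := by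
  rw [← Category.assoc, map₂_ι₂, Category.assoc]
  simp

theorem map₂_actionPullback {A G H K : C} (ψ : tensor₂ A G ⟶ A) (f : K ⟶ H) (g : H ⟶ G) :
    map₂ (𝟙 A) f ≫ actionPullback g ψ = actionPullback (f ≫ g) ψ := by
  rw [actionPullback, actionPullback, ← Category.assoc, map₂_comp, Category.comp_id]

theorem actionPullback_id {A G : C} (ψ : tensor₂ A G ⟶ A) : actionPullback (𝟙 G) ψ = ψ := by
  rw [actionPullback, map₂_id, Category.id_comp]

theorem conj_comp {A Z : C} (f : A ⟶ Z) : conj A ≫ f = ι₂ A A ≫ coprod.desc f f := by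
  rw [conj, Category.assoc]
  simp

/-! ### Compositions on a reflexive graph -/

namespace ReflexiveGraph

variable {Γ : ReflexiveGraph C} {A : C} {k : A ⟶ Γ.R}

/-- In an internal category, the conjugation action of the object of arrows on the kernel of the
domain morphism is the pullback of the action of the object of objects along the codomain
morphism. This is stated for generalized elements `q` of the object of arrows. -/
theorem ι₂_desc_of_isInternalCategory (E : IsSplitExtension k Γ.d Γ.e)
    (h : Γ.IsInternalCategory) {ψ : tensor₂ A Γ.G ⟶ A}
    (hψ : ι₂ A Γ.G ≫ coprod.desc k Γ.e = ψ ≫ k) {B : C} (q : B ⟶ Γ.R) (t : B ⟶ Γ.G)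
    (ht : q ≫ Γ.c = t) : ι₂ A B ≫ coprod.desc k q = actionPullback t ψ ≫ k := by
  obtain ⟨S⟩ := h
  have hk : pullback.lift k 0 (by simp [E.k_p]) ≫ S.comp = k := by
    have e : k ≫ (pullback.lift (𝟙 Γ.R) (Γ.d ≫ Γ.e) (by simp [Γ.e_c]) :
          Γ.R ⟶ pullback Γ.d Γ.c) =
        (pullback.lift k 0 (by simp [E.k_p]) : A ⟶ pullback Γ.d Γ.c) := by
      apply pullback.hom_ext <;> simp [reassoc_of% E.k_p]
    rw [← e, Category.assoc, S.comp_id, Category.comp_id]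
  have e := E.ι₂_desc_pullback_lift hψ Γ.c =≫ S.comp
  rw [Category.assoc (ι₂ A Γ.R), Category.assoc (actionPullback Γ.c ψ), hk, coprod.desc_comp, hk,
    S.id_comp] at e
  have e' := map₂ (𝟙 A) q ≫= e
  rwa [map₂_ι₂_desc, Category.comp_id, ← Category.assoc (map₂ _ _), map₂_actionPullback, ht] at e'

/-- A morphism on composable pairs, with prescribed restrictions to the kernel of the domain
morphism and to the pairs whose second component is an identity, exists as soon as the conjugation
action and the pullback of `ψ` along the codomain morphism agree on a regular cover. -/
theorem exists_comp_of_ι₂_desc (E : IsSplitExtension k Γ.d Γ.e)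
    {ψ : tensor₂ A Γ.G ⟶ A}
    (hψ : ι₂ A Γ.G ≫ coprod.desc k Γ.e = ψ ≫ k) {B : C} (q : B ⟶ Γ.R) [IsRegularEpi q]
    (t : B ⟶ Γ.G) (ht : q ≫ Γ.c = t) (h : ι₂ A B ≫ coprod.desc k q = actionPullback t ψ ≫ k) :
    ∃ m : pullback Γ.d Γ.c ⟶ Γ.R, pullback.lift k 0 (by simp [E.k_p]) ≫ m = k ∧
      pullback.lift (Γ.c ≫ Γ.e) (𝟙 Γ.R) (by simp [Γ.e_d]) ≫ m = 𝟙 Γ.R := by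
  subst ht
  -- The composition is first built on pairs `(β, b)` with `b` in the cover `B`, then descended
  -- along the regular epimorphism `r` induced by `q`. An element of the kernel of `r` is a pair
  -- `(0, b)` with `q b = 0`; it lies in the section, where `m` is `q`, so `m` kills it.
  obtain ⟨m, hm₁, hm₂⟩ := (E.pullback (q ≫ Γ.c)).exists_desc (actionPullback (q ≫ Γ.c) ψ)
    (E.ι₂_desc_pullback_lift hψ (q ≫ Γ.c)) k q h
  let r : pullback Γ.d (q ≫ Γ.c) ⟶ pullback Γ.d Γ.c :=
    pullback.lift (pullback.fst _ _) (pullback.snd _ _ ≫ q) (by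
      rw [pullback.condition, Category.assoc])
  have hr : IsPullback r (pullback.snd Γ.d (q ≫ Γ.c)) (pullback.snd Γ.d Γ.c) q :=
    IsPullback.of_right (by simpa [r] using IsPullback.of_hasPullback Γ.d (q ≫ Γ.c))
      (by simp [r]) (IsPullback.of_hasPullback Γ.d Γ.c)
  have : IsRegularEpi r :=
    Regular.regularEpiIsStableUnderBaseChange.of_isPullback hr.flip
      ((MorphismProperty.regularEpi_iff _).2 inferInstance)
  obtain ⟨t, ht⟩ := exists_desc_of_isRegularEpi r m (by
    have h₀ : kernel.ι r ≫ pullback.snd Γ.d (q ≫ Γ.c) ≫ q = 0 := by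
      rw [← hr.w, kernel.condition_assoc, zero_comp]
    have h₁ : kernel.ι r ≫ pullback.fst Γ.d (q ≫ Γ.c) = 0 := by
      have hf : r ≫ pullback.fst Γ.d Γ.c = pullback.fst Γ.d (q ≫ Γ.c) := by simp [r]
      rw [← hf, kernel.condition_assoc, zero_comp]
    have h₂ : kernel.ι r = (kernel.ι r ≫ pullback.snd Γ.d (q ≫ Γ.c)) ≫
        pullback.lift ((q ≫ Γ.c) ≫ Γ.e) (𝟙 _) (by simp [Γ.e_d]) := by
      apply pullback.hom_ext
      · simp only [Category.assoc, pullback.lift_fst, h₁, reassoc_of% h₀, zero_comp]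
      · simp
    rw [h₂, Category.assoc, hm₂, Category.assoc, h₀])
  refine ⟨t, ?_, ?_⟩
  · have e : pullback.lift k 0 (by simp [E.k_p]) ≫ r = pullback.lift k 0 (by simp [E.k_p]) := by
      apply pullback.hom_ext <;> simp [r]
    rw [← e, Category.assoc, ht, hm₁]
  · have e : pullback.lift ((q ≫ Γ.c) ≫ Γ.e) (𝟙 _) (by simp [Γ.e_d]) ≫ r =
        q ≫ pullback.lift (Γ.c ≫ Γ.e) (𝟙 Γ.R) (by simp [Γ.e_d]) := by
      apply pullback.hom_ext <;> simp [r]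
    rw [← cancel_epi q, ← Category.assoc q, ← e, Category.assoc _ r, ht, hm₂, Category.comp_id]

end ReflexiveGraph

/-! ### Precrossed modules -/

namespace PrecrossedModule

variable (M : PrecrossedModule C)

/-- The two conditions on a precrossed module say that conjugation in `A ⋊ G`, restricted along
`A + G ⟶ A ⋊ G`, is the pullback of `μ` along the codomain morphism. -/
theorem conditions_iff :
    (conj M.A = actionPullback M.bd M.μ ∧
      op₂₁ M.μ = map₃ (𝟙 M.A) M.bd (𝟙 M.G) ≫ op₁₂ M.μ) ↔
    ι₂ M.A (M.A ⨿ M.G) ≫ coprod.desc (semidirectK M.μ) (semidirectπ M.μ) =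
      actionPullback (coprod.desc M.bd (𝟙 M.G)) M.μ ≫ semidirectK M.μ := by
  have : Mono (semidirectK M.μ) := M.isAction
  have e₁ : map₂ (𝟙 M.A) coprod.inl ≫ ι₂ M.A (M.A ⨿ M.G) ≫
      coprod.desc (semidirectK M.μ) (semidirectπ M.μ) = conj M.A ≫ semidirectK M.μ := by
    rw [map₂_ι₂_desc, conj_comp, semidirectK]
  constructor
  · rintro ⟨h₁, h₂⟩
    refine tensor₂_coprod_hom_ext ?_ ?_ ?_
    · rw [e₁, ← Category.assoc, map₂_actionPullback, coprod.inl_desc, h₁]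
    · rw [map₂_ι₂_desc, ← Category.assoc, map₂_actionPullback, coprod.inr_desc,
        actionPullback_id, ← ι₂_semidirectπ, ← desc_semidirectK_semidirectS, coprod.inr_desc]
    · rw [assocCoprod_ι₂_desc, h₂, map₃_op₁₂, Category.assoc]
  · intro h
    refine ⟨?_, ?_⟩
    · rw [← cancel_mono (semidirectK M.μ), ← e₁, h, ← Category.assoc, map₂_actionPullback,
        coprod.inl_desc]
    · rw [← cancel_mono (semidirectK M.μ), ← assocCoprod_ι₂_desc, h, map₃_op₁₂, Category.assoc]

end PrecrossedModule

end

end CoSmash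

end

theorem theorem5p4 {C : Type u} [Category.{v} C] [HasZeroObject C] [HasZeroMorphisms C]
    [CoSmash.Homological C] [HasFiniteColimits C] (M : CoSmash.PrecrossedModule C) :
    M.IsCrossedModule ↔
      CoSmash.conj M.A = CoSmash.actionPullback M.bd M.μ ∧
      CoSmash.op₂₁ M.μ = CoSmash.map₃ (𝟙 M.A) M.bd (𝟙 M.G) ≫ CoSmash.op₁₂ M.μ := by
  have E : CoSmash.IsSplitExtension (CoSmash.semidirectK M.μ) M.reflexiveGraph.d
      M.reflexiveGraph.e := M.isAction.isSplitExtension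
  have hμ : CoSmash.ι₂ M.A M.G ≫ coprod.desc (CoSmash.semidirectK M.μ)
      (CoSmash.semidirectS M.μ) = M.μ ≫ CoSmash.semidirectK M.μ := by
    rw [CoSmash.desc_semidirectK_semidirectS, CoSmash.ι₂_semidirectπ]
  have hc : CoSmash.semidirectπ M.μ ≫ M.reflexiveGraph.c = coprod.desc M.bd (𝟙 M.G) :=
    CoSmash.semidirectπ_desc M.μ M.bd (𝟙 M.G) M.equivariant
  rw [M.conditions_iff]
  constructor
  · exact fun h => CoSmash.ReflexiveGraph.ι₂_desc_of_isInternalCategory E h hμ _ _ hc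
  · intro h
    let q : M.A ⨿ M.G ⟶ M.reflexiveGraph.R := CoSmash.semidirectπ M.μ
    have : IsRegularEpi q := inferInstanceAs (IsRegularEpi (coequalizer.π _ _))
    obtain ⟨m, hm₁, hm₂⟩ := CoSmash.ReflexiveGraph.exists_comp_of_ι₂_desc E hμ q _ hc h
    exact CoSmash.ReflexiveGraph.isInternalCategory_of_comp E m hm₁ hm₂
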